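/- Let $\mathfrak A$ be a $C^*$-algebra (not necessarily unital), let $H$, $K$, $E$ be Hilbert $\mathfrak A$-modules, and let $\mathcal L(H,K)$ denote the adjointable operators from $H$ to $K$, with $\mathcal L(H)=\mathcal L(H,H)$. Write $\mathcal R(T)$ and $\mathcal N(T)$ for the range and the null space of $T$. An operator $M\in\mathcal L(K)$ is a weight if $M=M^*$ and $M$ is invertible in $\mathcal L(K)$; it is positive definite if moreover it is positive, i.e. $\langle x,Mx\rangle\ge 0$ for all $x\in K$. For weights $M\in\mathcal L(K)$, $N\in\mathcal L(H)$ and $A\in\mathcal L(H,K)$, the weighted Moore–Penrose inverse $A^\dagger_{MN}$, if it exists, is the unique $X\in\mathcal L(K,H)$ with $$AXA=A,\quad XAX=X,\quad (MAX)^*=MAX,\quad (NXA)^*=NXA,$$ and $A^\dagger=A^\dagger_{I_KI_H}$. Let $A\in\mathcal L(H,K)$, $B\in\mathcal L(H,E)$ and let $V\in\mathcal L(K)$ be positive definite. Suppose that $(\mathcal R(A^*),\mathcal R(B^*))$ is a separated pair, that is, $\mathcal R(A^*)\cap\mathcal R(B^*)=\{0\}$ and $\mathcal R(A^*)+\mathcal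 R(B^*)$ is closed in $H$. Then the projection $P_{\mathcal N(A)\cap\mathcal N(B)}\in\mathcal L(H)$ of $H$ onto $\mathcal N(A)\cap\mathcal N(B)$ exists and, for every positive definite $W\in\mathcal L(E)$ and every real $t>0$, the operator $$U=A^*VA+B^*WB+P_{\mathcal N(A)\cap\mathcal N(B)}$$ is positive definite, $A^\dagger_{VU}$ and $(A^*VA+tB^*WB)^\dagger$ exist, and $$(A^*VA+tB^*WB)^\dagger A^*V=A^\dagger_{VU}.$$ Moreover, this operator depends neither on $t>0$ nor on the positive definite operator $W$ (although $U$ depends on $W$). -/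

import Mathlib

open scoped Pointwise

/-- The set `𝓛(H, K)` of adjointable operators between the Hilbert `𝔄`-modules `H` and `K`: maps
`T : H → K` for which there is a map `T⋆ : K → H` with `⟨T x, y⟩ = ⟨x, T⋆ y⟩` for all `x`, `y`.
The map `T⋆` is determined by `T` (see `Adjointable.ext`), so it is carried along as data. As
usual, linearity over `ℂ` and over `𝔄`, and boundedness, are automatic. -/
structure Adjointable (𝔄 H K : Type*) [NonUnitalCStarAlgebra 𝔄] [PartialOrder 𝔄]
    [StarOrderedRing 𝔄]
    [NormedAddCommGroup H] [NormedSpace ℂ H] [SMul 𝔄 H] [CStarModule 𝔄 H]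
    [NormedAddCommGroup K] [NormedSpace ℂ K] [SMul 𝔄 K] [CStarModule 𝔄 K] where
  /-- the operator -/
  toFun : H → K
  /-- its adjoint -/
  adjFun : K → H
  inner_adjFun : ∀ x y, inner 𝔄 (toFun x) y = inner 𝔄 x (adjFun y)

namespace Adjointable

variable {𝔄 H K E F : Type*} [NonUnitalCStarAlgebra 𝔄] [PartialOrder 𝔄] [StarOrderedRing 𝔄]
  [NormedAddCommGroup H] [NormedSpace ℂ H] [SMul 𝔄 H] [CStarModule 𝔄 H]
  [NormedAddCommGroup K] [NormedSpace ℂ K] [SMul 𝔄 K] [CStarModule 𝔄 K]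
  [NormedAddCommGroup E] [NormedSpace ℂ E] [SMul 𝔄 E] [CStarModule 𝔄 E]
  [NormedAddCommGroup F] [NormedSpace ℂ F] [SMul 𝔄 F] [CStarModule 𝔄 F]

instance : CoeFun (Adjointable 𝔄 H K) (fun _ => H → K) := ⟨toFun⟩

theorem eq_of_inner_left_eq (𝔄 : Type*) {H : Type*} [NonUnitalCStarAlgebra 𝔄] [PartialOrder 𝔄]
    [StarOrderedRing 𝔄] [NormedAddCommGroup H] [NormedSpace ℂ H] [SMul 𝔄 H] [CStarModule 𝔄 H]
    {y z : H} (h : ∀ x : H, inner 𝔄 x y = inner 𝔄 x z) : y = z := by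
  have h1 : inner 𝔄 (y - z) (y - z) = 0 := by
    rw [CStarModule.inner_sub_right, h (y - z), sub_self]
  exact sub_eq_zero.1 (CStarModule.inner_self.1 h1)

/-- An adjointable operator is determined by its underlying map. -/
theorem ext {S T : Adjointable 𝔄 H K} (h : ∀ x, S x = T x) : S = T := by
  obtain ⟨s, s', hs⟩ := S
  obtain ⟨t, t', ht⟩ := T
  obtain rfl : s = t := funext h
  obtain rfl : s' = t' := funext fun y =>
    eq_of_inner_left_eq 𝔄 fun x => by rw [← hs, ← ht]
  rfl

/-- The adjoint operator `T⋆`. -/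
def adjoint (T : Adjointable 𝔄 H K) : Adjointable 𝔄 K H where
  toFun := T.adjFun
  adjFun := T.toFun
  inner_adjFun x y := by
    rw [← CStarModule.star_inner (A := 𝔄) y, ← T.inner_adjFun, CStarModule.star_inner]

/-- The product `S T` of adjointable operators. -/
def comp (S : Adjointable 𝔄 K E) (T : Adjointable 𝔄 H K) : Adjointable 𝔄 H E where
  toFun x := S (T x)
  adjFun y := T.adjFun (S.adjFun y)
  inner_adjFun x y := by rw [S.inner_adjFun, T.inner_adjFun]

infixr:80 " ⊚ " => Adjointable.comp

/-- The identity operator. -/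
protected def id (𝔄 H : Type*) [NonUnitalCStarAlgebra 𝔄] [PartialOrder 𝔄] [StarOrderedRing 𝔄]
    [NormedAddCommGroup H] [NormedSpace ℂ H] [SMul 𝔄 H] [CStarModule 𝔄 H] :
    Adjointable 𝔄 H H where
  toFun x := x
  adjFun x := x
  inner_adjFun _ _ := rfl

instance : Add (Adjointable 𝔄 H K) where
  add S T :=
    { toFun := fun x => S x + T x
      adjFun := fun y => S.adjFun y + T.adjFun y
      inner_adjFun := fun x y => by
        rw [CStarModule.inner_add_left, CStarModule.inner_add_right, S.inner_adjFun,
          T.inner_adjFun] }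

noncomputable instance : SMul ℝ (Adjointable 𝔄 H K) where
  smul t T :=
    { toFun := fun x => t • T x
      adjFun := fun y => t • T.adjFun y
      inner_adjFun := fun x y => by
        rw [CStarModule.inner_smul_left_real, CStarModule.inner_smul_right_real,
          T.inner_adjFun] }

/-- The range `𝓡(T)`. -/
def range (T : Adjointable 𝔄 H K) : Set K := Set.range T.toFun

/-- The null space `𝓝(T)`. -/
def ker (T : Adjointable 𝔄 H K) : Set H := {x | T x = 0}

/-- `(𝓡(A⋆), 𝓡(B⋆))` is a separated pair: the two ranges meet only in `0`, and their algebraic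
sum is (norm-)closed in `H`. -/
def IsSeparatedPair (A : Adjointable 𝔄 H K) (B : Adjointable 𝔄 H E) : Prop :=
  A.adjoint.range ∩ B.adjoint.range = {0} ∧ IsClosed (A.adjoint.range + B.adjoint.range)

/-- `M` is a weight on `K`: self-adjoint and invertible in `𝓛(K)`. -/
def IsWeight (M : Adjointable 𝔄 K K) : Prop :=
  M.adjoint = M ∧ ∃ N : Adjointable 𝔄 K K, M ⊚ N = Adjointable.id 𝔄 K ∧
    N ⊚ M = Adjointable.id 𝔄 K

/-- `T ∈ 𝓛(K)` is positive: `⟨x, T x⟩ ≥ 0` in `𝔄` for all `x`. -/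
def IsPositive (T : Adjointable 𝔄 K K) : Prop := ∀ x, 0 ≤ inner 𝔄 x (T x)

/-- Positive definite operators are the positive weights. -/
def IsPosDef (M : Adjointable 𝔄 K K) : Prop := M.IsWeight ∧ M.IsPositive

/-- `P` is the projection (self-adjoint idempotent) from `H` onto `S`. -/
def IsProjectionOnto (P : Adjointable 𝔄 H H) (S : Set H) : Prop :=
  P ⊚ P = P ∧ P.adjoint = P ∧ P.range = S

/-- `X` is the weighted Moore-Penrose inverse `A†_{MN}` with respect to the weights `M` on `K` and
`N` on `H`. -/
def IsWeightedMPInverse (M : Adjointable 𝔄 K K) (N : Adjointable 𝔄 H H)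
    (A : Adjointable 𝔄 H K) (X : Adjointable 𝔄 K H) : Prop :=
  A ⊚ X ⊚ A = A ∧ X ⊚ A ⊚ X = X ∧
    (M ⊚ A ⊚ X).adjoint = M ⊚ A ⊚ X ∧ (N ⊚ X ⊚ A).adjoint = N ⊚ X ⊚ A

/-- `X` is the Moore-Penrose inverse `A†`. -/
def IsMPInverse (A : Adjointable 𝔄 H K) (X : Adjointable 𝔄 K H) : Prop :=
  IsWeightedMPInverse (Adjointable.id 𝔄 K) (Adjointable.id 𝔄 H) A X

/-! The relations just defined determine their objects. -/

theorem comp_assoc (R : Adjointable 𝔄 E F) (S : Adjointable 𝔄 K E) (T : Adjointable 𝔄 H K) :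
    (R ⊚ S) ⊚ T = R ⊚ S ⊚ T := rfl

theorem adjoint_comp (S : Adjointable 𝔄 K E) (T : Adjointable 𝔄 H K) :
    (S ⊚ T).adjoint = T.adjoint ⊚ S.adjoint := rfl

theorem isWeight_id : (Adjointable.id 𝔄 H).IsWeight := ⟨rfl, Adjointable.id 𝔄 H, rfl, rfl⟩

theorem IsProjectionOnto.unique {P Q : Adjointable 𝔄 H H} {S : Set H}
    (hP : P.IsProjectionOnto S) (hQ : Q.IsProjectionOnto S) : P = Q := by
  have key : ∀ {P Q : Adjointable 𝔄 H H}, P ⊚ P = P → P.range = Q.range → P ⊚ Q = Q := by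
    intro P Q h1 h2
    refine ext fun x => ?_
    have h3 : Q x ∈ P.range := h2 ▸ ⟨x, rfl⟩
    obtain ⟨y, hy⟩ := h3
    change P (Q x) = Q x
    rw [← hy]
    exact congrArg (fun T : Adjointable 𝔄 H H => T y) h1
  have h1 := key hP.1 (hP.2.2.trans hQ.2.2.symm)
  have h2 := key hQ.1 (hQ.2.2.trans hP.2.2.symm)
  have h3 := congrArg adjoint h1
  rw [adjoint_comp, hP.2.1, hQ.2.1, h2] at h3
  exact h3

/-- If `p`, `q` are idempotents with the same range that are self-adjoint with respect to a
weight, then they are equal. -/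
theorem eq_of_weighted_projections {M p q : Adjointable 𝔄 K K} (hM : M.IsWeight)
    (hp : (M ⊚ p).adjoint = M ⊚ p) (hq : (M ⊚ q).adjoint = M ⊚ q)
    (hpq : p ⊚ q = q) (hqp : q ⊚ p = p) : p = q := by
  obtain ⟨hM, N, -, hN⟩ := hM
  rw [adjoint_comp, hM] at hp hq
  have h : M ⊚ p = M ⊚ q := by
    calc M ⊚ p = M ⊚ q ⊚ p := by rw [hqp]
      _ = (M ⊚ q) ⊚ p := rfl
      _ = q.adjoint ⊚ M ⊚ p := by rw [← hq]; rfl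
      _ = (p ⊚ q).adjoint ⊚ M := by rw [← hp]; rfl
      _ = M ⊚ q := by rw [hpq, hq]
  have h2 : (N ⊚ M) ⊚ p = (N ⊚ M) ⊚ q := congrArg (fun T => N ⊚ T) h
  rw [hN] at h2
  exact h2

theorem eq_of_weighted_projections' {M p q : Adjointable 𝔄 K K} (hM : M.IsWeight)
    (hp : (M ⊚ p).adjoint = M ⊚ p) (hq : (M ⊚ q).adjoint = M ⊚ q)
    (hpq : p ⊚ q = p) (hqp : q ⊚ p = q) : p = q := by
  obtain ⟨hM, N, -, hN⟩ := hM
  rw [adjoint_comp, hM] at hp hq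
  have h : M ⊚ p = M ⊚ q := by
    calc M ⊚ p = p.adjoint ⊚ M := hp.symm
      _ = (p ⊚ q).adjoint ⊚ M := by rw [hpq]
      _ = q.adjoint ⊚ p.adjoint ⊚ M := rfl
      _ = q.adjoint ⊚ M ⊚ p := by rw [hp]
      _ = (q.adjoint ⊚ M) ⊚ p := rfl
      _ = M ⊚ q ⊚ p := by rw [hq]; rfl
      _ = M ⊚ q := by rw [hqp]
  have h2 : (N ⊚ M) ⊚ p = (N ⊚ M) ⊚ q := congrArg (fun T => N ⊚ T) h
  rw [hN] at h2
  exact h2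

theorem IsWeightedMPInverse.unique {M : Adjointable 𝔄 K K} {N : Adjointable 𝔄 H H}
    {A : Adjointable 𝔄 H K} {X Y : Adjointable 𝔄 K H} (hM : M.IsWeight) (hN : N.IsWeight)
    (hX : IsWeightedMPInverse M N A X) (hY : IsWeightedMPInverse M N A Y) : X = Y := by
  obtain ⟨x1, x2, x3, x4⟩ := hX
  obtain ⟨y1, y2, y3, y4⟩ := hY
  have h1 : A ⊚ X = A ⊚ Y := eq_of_weighted_projections hM x3 y3
    (congrArg (fun T => T ⊚ Y) x1) (congrArg (fun T => T ⊚ X) y1)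
  have h2 : X ⊚ A = Y ⊚ A := eq_of_weighted_projections' hN x4 y4
    (congrArg (fun T => X ⊚ T) y1) (congrArg (fun T => Y ⊚ T) x1)
  calc X = X ⊚ A ⊚ X := x2.symm
    _ = X ⊚ A ⊚ Y := by rw [h1]
    _ = (X ⊚ A) ⊚ Y := rfl
    _ = Y ⊚ A ⊚ Y := by rw [h2]; rfl
    _ = Y := y2

end Adjointable

/-! Let `T = (A, B) : H → K ⊕ E` and `D = V ⊕ W`, so that `A⋆VA + B⋆WB = T⋆DT`, while
`𝓡(T⋆) = 𝓡(A⋆) + 𝓡(B⋆)` is closed and `𝓝(T) = 𝓝(A) ∩ 𝓝(B)`. By the open mapping theorem `T` is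
bounded below on `𝓡(T⋆)`, and by positivity so is `T⋆DT + t`, uniformly in `t ≥ 0`. This operator is
invertible on `𝓡(T⋆)` for large `t`, hence, by connectedness of `[0, ∞)`, for `t = 0`. Therefore
`H = 𝓡(T⋆) ⊕ 𝓝(T)` orthogonally, which gives the projection `P`, and `U = T⋆DT + P` is invertible.

If `U q = A⋆k`, then `P q = 0`, and since `𝓡(A⋆)` and `𝓡(B⋆)` meet only in `0`, also `B q = 0` and
`A⋆VA q = A⋆k`. These equations do not involve `W`, so neither does `U⁻¹A⋆`; replacing `W` by `tW`
settles the dependence on `t`. -/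

theorem isUnit_of_isPreconnected_of_norm_inv_le {R : Type*} [NormedRing R]
    [HasSummableGeomSeries R] {s : Set R} (hs : IsPreconnected s) {C : ℝ}
    (hC : ∀ u : Rˣ, (u : R) ∈ s → ‖(↑u⁻¹ : R)‖ ≤ C) {a b : R} (ha : a ∈ s) (hau : IsUnit a)
    (hb : b ∈ s) : IsUnit b := by
  let O : Set R := Units.val '' {u : Rˣ | ‖(↑u⁻¹ : R)‖ < C + 1}
  have hO : IsOpen O := Units.isOpenMap_val _ <|
    isOpen_lt (Units.continuous_val.comp continuous_inv).norm continuous_const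
  have mem_O : ∀ u : Rˣ, (u : R) ∈ s → (u : R) ∈ O := fun u hu =>
    ⟨u, (hC u hu).trans_lt (lt_add_one C), rfl⟩
  have hclosure : closure O ∩ s ⊆ O := by
    rintro x ⟨hxO, hxs⟩
    have hC0 : 0 < C + 1 := by
      obtain ⟨u, rfl⟩ := hau
      linarith [hC u ha, norm_nonneg (↑u⁻¹ : R)]
    obtain ⟨_, ⟨u, hu, rfl⟩, hxu⟩ := Metric.mem_closure_iff.1 hxO (C + 1)⁻¹ (inv_pos.2 hC0)
    rw [dist_eq_norm] at hxu
    rcases subsingleton_or_nontrivial R with _ | _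
    · exact ⟨u, hu, Subsingleton.elim _ _⟩
    · exact mem_O (u.ofNearby x (hxu.trans (inv_strictAnti₀ (Units.norm_pos _) hu))) hxs
  obtain ⟨u, -, rfl⟩ := hs.subset_of_closure_inter_subset hO
    (by obtain ⟨u, rfl⟩ := hau; exact ⟨u, ha, mem_O u ha⟩) hclosure hb
  exact u.isUnit

theorem surjective_of_forall_le_norm_add_smul {𝕜 X : Type*} [RCLike 𝕜] [NormedAddCommGroup X]
    [NormedSpace 𝕜 X] [CompleteSpace X] (G : X →L[𝕜] X) {c : ℝ} (hc : 0 < c)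
    (h : ∀ t : ℝ, 0 ≤ t → ∀ x, c * ‖x‖ ≤ ‖G x + (t : 𝕜) • x‖) : Function.Surjective G := by
  let T : ℝ → X →L[𝕜] X := fun t => G + (t : 𝕜) • 1
  have hT : IsPreconnected (T '' Set.Ici 0) :=
    isPreconnected_Ici.image _ (by fun_prop)
  have hinv : ∀ u : (X →L[𝕜] X)ˣ, (u : X →L[𝕜] X) ∈ T '' Set.Ici 0 →
      ‖(↑u⁻¹ : X →L[𝕜] X)‖ ≤ c⁻¹ := by
    rintro u ⟨t, ht, htu⟩
    refine ContinuousLinearMap.opNorm_le_bound _ (inv_nonneg.2 hc.le) fun x => ?_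
    have hux : T t ((↑u⁻¹ : X →L[𝕜] X) x) = x := by
      rw [htu]
      exact DFunLike.congr_fun u.mul_inv x
    rw [inv_mul_eq_div, le_div_iff₀' hc]
    exact (h t ht _).trans_eq (congrArg norm hux)
  have hlarge : IsUnit (T (‖G‖ * ‖(1 : X →L[𝕜] X)‖ + 1)) := by
    set r := ‖G‖ * ‖(1 : X →L[𝕜] X)‖ + 1 with hr
    have hr0 : 0 ≤ r := by positivity
    have hres : (r : 𝕜) ∈ resolventSet 𝕜 (-G) := spectrum.mem_resolventSet_of_norm_lt_mul <| by
      rw [norm_neg, RCLike.norm_of_nonneg hr0, hr]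
      exact lt_add_one _
    rw [spectrum.mem_resolventSet_iff, Algebra.algebraMap_eq_smul_one, sub_neg_eq_add,
      add_comm] at hres
    exact hres
  have hG : IsUnit (T 0) := isUnit_of_isPreconnected_of_norm_inv_le hT hinv
    ⟨_, by simp only [Set.mem_Ici]; positivity, rfl⟩ hlarge ⟨0, Set.self_mem_Ici, rfl⟩
  have hT0 : T 0 = G := by simp only [T, RCLike.ofReal_zero, zero_smul, add_zero]
  rw [hT0] at hG
  obtain ⟨u, rfl⟩ := hG
  exact fun y => ⟨(↑u⁻¹ : X →L[𝕜] X) y, DFunLike.congr_fun u.mul_inv y⟩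

namespace Adjointable

section Basic

variable {𝔄 H K E : Type*} [NonUnitalCStarAlgebra 𝔄] [PartialOrder 𝔄] [StarOrderedRing 𝔄]
  [NormedAddCommGroup H] [NormedSpace ℂ H] [SMul 𝔄 H] [CStarModule 𝔄 H]
  [NormedAddCommGroup K] [NormedSpace ℂ K] [SMul 𝔄 K] [CStarModule 𝔄 K]
  [NormedAddCommGroup E] [NormedSpace ℂ E] [SMul 𝔄 E] [CStarModule 𝔄 E]

theorem inner_adjoint_right (T : Adjointable 𝔄 H K) (x : H) (y : K) :
    inner 𝔄 x (T.adjoint y) = inner 𝔄 (T x) y :=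
  (T.inner_adjFun x y).symm

theorem inner_adjoint_left (T : Adjointable 𝔄 H K) (x : K) (y : H) :
    inner 𝔄 (T.adjoint x) y = inner 𝔄 x (T y) :=
  T.adjoint.inner_adjFun x y

theorem comp_apply (S : Adjointable 𝔄 K E) (T : Adjointable 𝔄 H K) (x : H) :
    (S ⊚ T) x = S (T x) := rfl

theorem add_apply (S T : Adjointable 𝔄 H K) (x : H) : (S + T) x = S x + T x := rfl

theorem smul_apply (t : ℝ) (T : Adjointable 𝔄 H K) (x : H) : (t • T) x = t • T x := rfl

theorem adjoint_adjoint (T : Adjointable 𝔄 H K) : T.adjoint.adjoint = T := rfl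

theorem adjoint_add (S T : Adjointable 𝔄 H K) : (S + T).adjoint = S.adjoint + T.adjoint := rfl

theorem adjoint_smul (t : ℝ) (T : Adjointable 𝔄 H K) : (t • T).adjoint = t • T.adjoint := rfl

theorem congr_apply {S T : Adjointable 𝔄 H K} (h : S = T) (x : H) : S x = T x := h ▸ rfl

/-- An adjointable operator as a `ℂ`-linear map. -/
def toLinearMap (T : Adjointable 𝔄 H K) : H →ₗ[ℂ] K where
  toFun := T
  map_add' x y := eq_of_inner_left_eq 𝔄 fun z => by
    simp only [CStarModule.inner_add_right, ← T.inner_adjoint_left]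
  map_smul' c x := eq_of_inner_left_eq 𝔄 fun z => by
    simp only [RingHom.id_apply, CStarModule.inner_smul_right_complex, ← T.inner_adjoint_left]

theorem map_zero (T : Adjointable 𝔄 H K) : T 0 = 0 := T.toLinearMap.map_zero

theorem map_add (T : Adjointable 𝔄 H K) (x y : H) : T (x + y) = T x + T y :=
  T.toLinearMap.map_add x y

theorem map_sub (T : Adjointable 𝔄 H K) (x y : H) : T (x - y) = T x - T y :=
  T.toLinearMap.map_sub x y

theorem map_smul (T : Adjointable 𝔄 H K) (t : ℝ) (x : H) : T (t • x) = t • T x :=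
  (T.toLinearMap.restrictScalars ℝ).map_smul t x

/-- An adjointable operator between complete modules as a continuous linear map; continuity is the
closed graph theorem. -/
def toCLM [CompleteSpace H] [CompleteSpace K] (T : Adjointable 𝔄 H K) : H →L[ℂ] K where
  toLinearMap := T.toLinearMap
  cont := T.toLinearMap.continuous_of_seq_closed_graph fun u x y hu hTu =>
    eq_of_inner_left_eq 𝔄 fun z => by
      have tendsto_y := ((CStarModule.innerSL (A := 𝔄) z).continuous.tendsto y).comp hTu
      have tendsto_Tx :=
        ((CStarModule.innerSL (A := 𝔄) (T.adjoint z)).continuous.tendsto x).comp hu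
      exact (tendsto_nhds_unique tendsto_y
        (tendsto_Tx.congr fun n => T.inner_adjoint_left z (u n))).trans (T.inner_adjoint_left z x)

theorem adjoint_eq_self_of_comp_eq_id {U Q : Adjointable 𝔄 H H} (hU : U.adjoint = U)
    (hQ : U ⊚ Q = Adjointable.id 𝔄 H) : Q.adjoint = Q := by
  have hQU : Q.adjoint ⊚ U = Adjointable.id 𝔄 H := by
    conv_lhs => rw [← hU, ← adjoint_comp, hQ]
    rfl
  calc Q.adjoint = Q.adjoint ⊚ U ⊚ Q := by rw [hQ]; rfl
    _ = (Q.adjoint ⊚ U) ⊚ Q := rfl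
    _ = Q := by rw [hQU]; rfl

theorem isWeight_of_surjective {U : Adjointable 𝔄 H H} (hU : U.adjoint = U)
    (hsurj : Function.Surjective U) : U.IsWeight := by
  have symm : ∀ x y, inner 𝔄 (U x) y = inner 𝔄 x (U y) := fun x y => by
    rw [← U.inner_adjoint_left, hU]
  have hinj : ∀ x y, U x = U y → x = y := fun x y hxy => by
    have hinner : ∀ z, inner 𝔄 z x = inner 𝔄 z y := fun z => by
      obtain ⟨w, rfl⟩ := hsurj z
      rw [symm, symm, hxy]
    exact eq_of_inner_left_eq 𝔄 hinner
  choose N hN using hsurj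
  refine ⟨hU, ⟨N, N, fun x y => ?_⟩, ext hN, ext fun x => hinj _ _ (hN (U x))⟩
  conv_lhs => rw [← hN y, ← symm, hN]

end Basic

section PositiveDefinite

variable {𝔄 H K : Type*} [NonUnitalCStarAlgebra 𝔄] [PartialOrder 𝔄] [StarOrderedRing 𝔄]
  [NormedAddCommGroup H] [NormedSpace ℂ H] [SMul 𝔄 H] [CStarModule 𝔄 H]
  [NormedAddCommGroup K] [NormedSpace ℂ K] [SMul 𝔄 K] [CStarModule 𝔄 K]

theorem isPosDef_id : (Adjointable.id 𝔄 H).IsPosDef :=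
  ⟨isWeight_id, fun _ => CStarModule.inner_self_nonneg⟩

theorem IsPosDef.smul {V : Adjointable 𝔄 K K} (hV : V.IsPosDef) {t : ℝ} (ht : 0 < t) :
    (t • V).IsPosDef := by
  obtain ⟨⟨hVadj, N, hVN, hNV⟩, hVpos⟩ := hV
  refine ⟨⟨by rw [adjoint_smul, hVadj], t⁻¹ • N, ext fun x => ?_, ext fun x => ?_⟩, fun x => ?_⟩
  · rw [comp_apply, smul_apply, smul_apply, V.map_smul, smul_inv_smul₀ ht.ne']
    exact congr_apply hVN x
  · rw [comp_apply, smul_apply, smul_apply, N.map_smul, inv_smul_smul₀ ht.ne']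
    exact congr_apply hNV x
  · rw [smul_apply, CStarModule.inner_smul_right_real]
    exact smul_nonneg ht.le (hVpos x)

theorem IsPositive.inner_add_inner_le {V : Adjointable 𝔄 K K} (hV : V.IsPositive) (x y : K) :
    inner 𝔄 x (V y) + inner 𝔄 y (V x) ≤ inner 𝔄 x (V x) + inner 𝔄 y (V y) := by
  have hsub := hV (x - y)
  simp only [map_sub, CStarModule.inner_sub_left, CStarModule.inner_sub_right] at hsub
  rw [← sub_nonneg]
  convert hsub using 1
  abel

theorem IsPosDef.exists_le_norm_inner [CompleteSpace K] {V : Adjointable 𝔄 K K}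
    (hV : V.IsPosDef) : ∃ c > 0, ∀ y : K, c * ‖y‖ ^ 2 ≤ ‖(inner 𝔄 y (V y) : 𝔄)‖ := by
  obtain ⟨⟨hVadj, N, hVN, -⟩, hVpos⟩ := hV
  obtain ⟨m, hm, hN⟩ := N.toCLM.bound
  refine ⟨m⁻¹, inv_pos.2 hm, fun y => ?_⟩
  have hVNy : V (N y) = y := congr_apply hVN y
  have hNyV : inner 𝔄 (N y) (V y) = inner 𝔄 y y := by
    rw [← V.inner_adjoint_left, hVadj, hVNy]
  have hNyy : ‖(inner 𝔄 (N y) y : 𝔄)‖ ≤ m * ‖y‖ ^ 2 := by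
    calc ‖(inner 𝔄 (N y) y : 𝔄)‖ ≤ ‖N y‖ * ‖y‖ := CStarModule.norm_inner_le K
      _ ≤ (m * ‖y‖) * ‖y‖ := by gcongr; exact hN y
      _ = m * ‖y‖ ^ 2 := by ring
  -- Cauchy–Schwarz for `⟨·, V ·⟩` at `m⁻¹ • N y` and `y`, in the form `2ab ≤ a² + b²`.
  have hle : (2 * m⁻¹) • (inner 𝔄 y y : 𝔄) ≤
      (m⁻¹ * m⁻¹) • (inner 𝔄 (N y) y : 𝔄) + inner 𝔄 y (V y) := by
    have h := hVpos.inner_add_inner_le (m⁻¹ • N y) y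
    simp only [V.map_smul, hVNy, CStarModule.inner_smul_left_real,
      CStarModule.inner_smul_right_real, hNyV] at h
    rwa [two_mul, add_smul, mul_smul]
  have hnorm : 2 * m⁻¹ * ‖y‖ ^ 2 ≤ m⁻¹ * ‖y‖ ^ 2 + ‖(inner 𝔄 y (V y) : 𝔄)‖ := by
    calc 2 * m⁻¹ * ‖y‖ ^ 2 = ‖(2 * m⁻¹) • (inner 𝔄 y y : 𝔄)‖ := by
          rw [norm_smul_of_nonneg (by positivity), ← CStarModule.norm_sq_eq]
      _ ≤ ‖(m⁻¹ * m⁻¹) • (inner 𝔄 (N y) y : 𝔄) + inner 𝔄 y (V y)‖ :=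
        CStarAlgebra.norm_le_norm_of_nonneg_of_le
          (smul_nonneg (by positivity) CStarModule.inner_self_nonneg) hle
      _ ≤ m⁻¹ * m⁻¹ * ‖(inner 𝔄 (N y) y : 𝔄)‖ + ‖(inner 𝔄 y (V y) : 𝔄)‖ :=
        (norm_add_le _ _).trans_eq (by rw [norm_smul_of_nonneg (by positivity)])
      _ ≤ m⁻¹ * m⁻¹ * (m * ‖y‖ ^ 2) + ‖(inner 𝔄 y (V y) : 𝔄)‖ := by gcongr
      _ = m⁻¹ * ‖y‖ ^ 2 + ‖(inner 𝔄 y (V y) : 𝔄)‖ := by field_simp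
  linarith

theorem IsPosDef.eq_zero_of_inner_eq_zero [CompleteSpace K] {V : Adjointable 𝔄 K K}
    (hV : V.IsPosDef) {y : K} (h : (inner 𝔄 y (V y) : 𝔄) = 0) : y = 0 := by
  obtain ⟨c, hc, hV⟩ := hV.exists_le_norm_inner
  have hy : c * ‖y‖ ^ 2 ≤ 0 := (hV y).trans_eq (by rw [h, norm_zero])
  exact norm_eq_zero.1 <| eq_zero_of_pow_eq_zero <|
    le_antisymm (nonpos_of_mul_nonpos_right hy hc) (sq_nonneg ‖y‖)

theorem IsPositive.le_norm_add_smul {S : Adjointable 𝔄 H H} (hS : S.IsPositive) {c : ℝ} {x : H}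
    (hx : c * ‖x‖ ^ 2 ≤ ‖(inner 𝔄 x (S x) : 𝔄)‖) {t : ℝ} (ht : 0 ≤ t) :
    c * ‖x‖ ≤ ‖S x + t • x‖ := by
  rcases eq_or_ne x 0 with rfl | hx0
  · rw [norm_zero, mul_zero]
    exact norm_nonneg _
  refine le_of_mul_le_mul_left ?_ (norm_pos_iff.2 hx0)
  calc ‖x‖ * (c * ‖x‖) = c * ‖x‖ ^ 2 := by ring
    _ ≤ ‖(inner 𝔄 x (S x) : 𝔄)‖ := hx
    _ ≤ ‖(inner 𝔄 x (S x + t • x) : 𝔄)‖ := by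
      refine CStarAlgebra.norm_le_norm_of_nonneg_of_le (hS x) ?_
      rw [CStarModule.inner_add_right, CStarModule.inner_smul_right_real]
      exact le_add_of_nonneg_right (smul_nonneg ht CStarModule.inner_self_nonneg)
    _ ≤ ‖x‖ * ‖S x + t • x‖ := CStarModule.norm_inner_le H

theorem IsPositive.surjOn_of_coercive [CompleteSpace H] {S : Adjointable 𝔄 H H}
    (hS : S.IsPositive) {R : Submodule ℂ H} (hR : IsClosed (R : Set H))
    (hSR : Set.MapsTo S (R : Set H) R) {c : ℝ} (hc : 0 < c)
    (hcoer : ∀ x ∈ R, c * ‖x‖ ^ 2 ≤ ‖(inner 𝔄 x (S x) : 𝔄)‖) :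
    Set.SurjOn S (R : Set H) R := by
  have : CompleteSpace R := hR.completeSpace_coe
  let G : R →L[ℂ] R := S.toCLM.restrict hSR
  have hG : Function.Surjective G := surjective_of_forall_le_norm_add_smul G hc fun t ht x =>
    hS.le_norm_add_smul (hcoer x x.2) ht
  intro y hy
  obtain ⟨x, hx⟩ := hG ⟨y, hy⟩
  exact ⟨x, x.2, congrArg Subtype.val hx⟩

end PositiveDefinite

section Projection

variable {𝔄 H K : Type*} [NonUnitalCStarAlgebra 𝔄] [PartialOrder 𝔄] [StarOrderedRing 𝔄]
  [NormedAddCommGroup H] [NormedSpace ℂ H] [SMul 𝔄 H] [CStarModule 𝔄 H]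
  [NormedAddCommGroup K] [NormedSpace ℂ K] [SMul 𝔄 K] [CStarModule 𝔄 K]
  {P : Adjointable 𝔄 H H}

theorem exists_isProjectionOnto_of_orthogonal_decomposition {S : Set H}
    (h : ∀ x, ∃ n ∈ S, ∀ m ∈ S, inner 𝔄 m (x - n) = 0) :
    ∃ P : Adjointable 𝔄 H H, P.IsProjectionOnto S := by
  choose p hpS horth using h
  have inner_p_left : ∀ x y, inner 𝔄 (p x) y = inner 𝔄 (p x) (p y) := fun x y =>
    sub_eq_zero.1 <| by rw [← CStarModule.inner_sub_right, horth y _ (hpS x)]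
  have inner_p_right : ∀ x y, inner 𝔄 x (p y) = inner 𝔄 (p x) (p y) := fun x y => by
    rw [← CStarModule.star_inner, inner_p_left, CStarModule.star_inner]
  have hfix : ∀ n ∈ S, p n = n := fun n hn => by
    have hinner : inner 𝔄 (n - p n) (n - p n) = 0 := by
      rw [CStarModule.inner_sub_left, horth n n hn, horth n _ (hpS n), sub_zero]
    exact (sub_eq_zero.1 (CStarModule.inner_self.1 hinner)).symm
  refine ⟨⟨p, p, fun x y => (inner_p_left x y).trans (inner_p_right x y).symm⟩,
    ext fun x => hfix _ (hpS x), rfl, Set.Subset.antisymm ?_ fun n hn => ⟨n, hfix n hn⟩⟩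
  rintro _ ⟨x, rfl⟩
  exact hpS x

theorem IsProjectionOnto.apply_mem {S : Set H} (hP : P.IsProjectionOnto S) (x : H) : P x ∈ S :=
  hP.2.2 ▸ ⟨x, rfl⟩

theorem IsProjectionOnto.apply_of_mem {S : Set H} (hP : P.IsProjectionOnto S) {x : H}
    (hx : x ∈ S) : P x = x := by
  obtain ⟨z, rfl⟩ := hP.2.2.symm ▸ hx
  exact congr_apply hP.1 z

theorem IsProjectionOnto.isPositive {S : Set H} (hP : P.IsProjectionOnto S) : P.IsPositive := by
  intro x
  have hinner : inner 𝔄 x (P x) = inner 𝔄 (P x) (P x) := by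
    rw [← P.inner_adjoint_right, hP.2.1, hP.apply_of_mem (hP.apply_mem x)]
  exact hinner ▸ CStarModule.inner_self_nonneg

theorem IsProjectionOnto.apply_adjoint_eq_zero {S : Set H} (hP : P.IsProjectionOnto S)
    {T : Adjointable 𝔄 H K} (hST : S ⊆ T.ker) (k : K) : P (T.adjoint k) = 0 := by
  refine eq_of_inner_left_eq 𝔄 fun x => ?_
  have hTP : T (P x) = 0 := hST (hP.apply_mem x)
  rw [← P.inner_adjoint_left, hP.2.1, T.inner_adjoint_right, hTP, CStarModule.inner_zero_left,
    CStarModule.inner_zero_right]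

theorem IsPositive.isPosDef_add_projection {S : Adjointable 𝔄 H H} (hS : S.IsPositive)
    (hSadj : S.adjoint = S) (hP : P.IsProjectionOnto S.ker)
    (hsurj : ∀ y, ∃ x, S x = y - P y) : (S + P).IsPosDef := by
  refine ⟨isWeight_of_surjective (by rw [adjoint_add, hSadj, hP.2.1]) fun y => ?_, fun x => ?_⟩
  · obtain ⟨x, hx⟩ := hsurj y
    have hSP : ∀ z, S (P z) = 0 := hP.apply_mem
    have hPP : ∀ z, P (P z) = P z := fun z => hP.apply_of_mem (hP.apply_mem z)
    refine ⟨x - P x + P y, ?_⟩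
    rw [add_apply, map_add, map_add, map_sub, map_sub, hSP, hSP, hPP, hPP, hx]
    abel
  · rw [add_apply, CStarModule.inner_add_right]
    exact add_nonneg (hS x) (hP.isPositive x)

/-- `Q S Q = (S + P)⁻¹ - P`, since `Q` commutes with `S` and `S Q = 1 - P`. -/
theorem isMPInverse_of_inverse_add_projection {S Q : Adjointable 𝔄 H H} (hS : S.adjoint = S)
    (hP : P.IsProjectionOnto S.ker) (hSPQ : (S + P) ⊚ Q = Adjointable.id 𝔄 H)
    (hQSP : Q ⊚ (S + P) = Adjointable.id 𝔄 H) : IsMPInverse S (Q ⊚ S ⊚ Q) := by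
  have hSP : ∀ x, S (P x) = 0 := hP.apply_mem
  have hPS : ∀ x, P (S x) = 0 := fun x => by
    have h := hP.apply_adjoint_eq_zero subset_rfl x
    rwa [hS] at h
  have apply_Q : ∀ x, S (Q x) + P (Q x) = x := congr_apply hSPQ
  have Q_apply : ∀ x, Q (S x + P x) = x := congr_apply hQSP
  have comm : Q ⊚ S = S ⊚ Q := ext fun x => by
    calc Q (S x) = Q (S (S (Q x) + P (Q x))) := by rw [apply_Q]
      _ = Q (S (S (Q x)) + P (S (Q x))) := by rw [S.map_add, hSP, hPS]
      _ = S (Q x) := Q_apply _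
  have hSQS : S ⊚ Q ⊚ S = S := ext fun x => by
    have h := apply_Q (S x)
    rwa [show P (Q (S x)) = 0 from (congrArg P (congr_apply comm x)).trans (hPS _), add_zero] at h
  have hQadj : Q.adjoint = Q :=
    adjoint_eq_self_of_comp_eq_id (by rw [adjoint_add, hS, hP.2.1]) hSPQ
  have hSY : S ⊚ Q ⊚ S ⊚ Q = S ⊚ Q := congrArg (· ⊚ Q) hSQS
  have hYS : (Q ⊚ S ⊚ Q) ⊚ S = S ⊚ Q := (congrArg (Q ⊚ ·) hSQS).trans comm
  have hSQadj : (S ⊚ Q).adjoint = S ⊚ Q := by rw [adjoint_comp, hQadj, hS, comm]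
  refine ⟨?_, ?_, ?_, ?_⟩
  · rw [hYS, ← comm, hSQS]
  · rw [hSY]
    exact congrArg (Q ⊚ ·) hSY
  · change (S ⊚ Q ⊚ S ⊚ Q).adjoint = S ⊚ Q ⊚ S ⊚ Q
    rw [hSY, hSQadj]
  · change ((Q ⊚ S ⊚ Q) ⊚ S).adjoint = (Q ⊚ S ⊚ Q) ⊚ S
    rw [hYS, hSQadj]

end Projection

section ClosedRange

variable {𝔄 H K : Type*} [NonUnitalCStarAlgebra 𝔄] [PartialOrder 𝔄] [StarOrderedRing 𝔄]
  [NormedAddCommGroup H] [NormedSpace ℂ H] [SMul 𝔄 H] [CStarModule 𝔄 H]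
  [NormedAddCommGroup K] [NormedSpace ℂ K] [SMul 𝔄 K] [CStarModule 𝔄 K] [CompleteSpace K]
  {T : Adjointable 𝔄 H K} {D : Adjointable 𝔄 K K}

theorem ker_adjoint_comp_comp (hD : D.IsPosDef) : (T.adjoint ⊚ D ⊚ T).ker = T.ker := by
  ext x
  constructor
  · intro hx
    have hx0 : T.adjoint (D (T x)) = 0 := hx
    refine hD.eq_zero_of_inner_eq_zero (𝔄 := 𝔄) ?_
    rw [← T.inner_adjoint_right, hx0, CStarModule.inner_zero_right]
  · intro hx
    have hx0 : T x = 0 := hx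
    change T.adjoint (D (T x)) = 0
    rw [hx0, map_zero, map_zero]

variable [CompleteSpace H]

theorem exists_norm_le_of_isClosed_range_adjoint (hT : IsClosed T.adjoint.range) :
    ∃ c > 0, ∀ x ∈ T.adjoint.range, ‖x‖ ≤ c * ‖T x‖ := by
  have : CompleteSpace T.adjoint.toLinearMap.range := IsClosed.completeSpace_coe (hs := hT)
  obtain ⟨c, hc, hpre⟩ := (T.adjoint.toCLM.codRestrict T.adjoint.toLinearMap.range
    fun k => ⟨k, rfl⟩).exists_preimage_norm_le (by rintro ⟨_, k, rfl⟩; exact ⟨k, rfl⟩)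
  refine ⟨c, hc, fun x hx => ?_⟩
  obtain ⟨k, hk, hkx⟩ := hpre ⟨x, hx⟩
  have hTk : T.adjoint k = x := congrArg Subtype.val hk
  rcases eq_or_ne x 0 with rfl | hx0
  · rw [norm_zero]
    positivity
  refine le_of_mul_le_mul_right ?_ (norm_pos_iff.2 hx0)
  calc ‖x‖ * ‖x‖ = ‖inner 𝔄 x (T.adjoint k)‖ := by rw [hTk, ← CStarModule.norm_sq_eq, sq]
    _ = ‖inner 𝔄 (T x) k‖ := by rw [T.inner_adjoint_right]
    _ ≤ ‖T x‖ * ‖k‖ := CStarModule.norm_inner_le K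
    _ ≤ ‖T x‖ * (c * ‖x‖) := by gcongr; exact hkx
    _ = c * ‖T x‖ * ‖x‖ := by ring

theorem surjOn_adjoint_comp_comp (hT : IsClosed T.adjoint.range) (hD : D.IsPosDef) :
    Set.SurjOn (T.adjoint ⊚ D ⊚ T) T.adjoint.range T.adjoint.range := by
  obtain ⟨c, hc, hTx⟩ := exists_norm_le_of_isClosed_range_adjoint hT
  obtain ⟨d, hd, hDx⟩ := hD.exists_le_norm_inner
  have hinner : ∀ x, inner 𝔄 x ((T.adjoint ⊚ D ⊚ T) x) = inner 𝔄 (T x) (D (T x)) := fun x =>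
    T.inner_adjoint_right x _
  refine IsPositive.surjOn_of_coercive (R := T.adjoint.toLinearMap.range)
    (fun x => hinner x ▸ hD.2 (T x)) hT (fun x _ => ⟨_, rfl⟩)
    (c := d / c ^ 2) (by positivity) fun x hx => ?_
  calc d / c ^ 2 * ‖x‖ ^ 2 ≤ d / c ^ 2 * (c * ‖T x‖) ^ 2 := by gcongr; exact hTx x hx
    _ = d * ‖T x‖ ^ 2 := by field_simp
    _ ≤ ‖inner 𝔄 x ((T.adjoint ⊚ D ⊚ T) x)‖ := hinner x ▸ hDx (T x)

theorem exists_mem_range_adjoint_sub_mem_ker (hT : IsClosed T.adjoint.range) (x : H) :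
    ∃ r ∈ T.adjoint.range, x - r ∈ T.ker := by
  obtain ⟨r, hr, hrx⟩ := surjOn_adjoint_comp_comp hT isPosDef_id
    (show T.adjoint (T x) ∈ T.adjoint.range from ⟨_, rfl⟩)
  refine ⟨r, hr, ?_⟩
  rw [← ker_adjoint_comp_comp isPosDef_id]
  change (T.adjoint ⊚ Adjointable.id 𝔄 K ⊚ T) (x - r) = 0
  rw [map_sub, hrx]
  exact sub_self _

theorem exists_isProjectionOnto_ker (hT : IsClosed T.adjoint.range) :
    ∃ P : Adjointable 𝔄 H H, P.IsProjectionOnto T.ker := by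
  refine exists_isProjectionOnto_of_orthogonal_decomposition fun x => ?_
  obtain ⟨_, ⟨k, rfl⟩, hker⟩ := exists_mem_range_adjoint_sub_mem_ker hT x
  refine ⟨_, hker, fun m hm => ?_⟩
  have hm0 : T m = 0 := hm
  rw [sub_sub_cancel]
  exact (T.inner_adjoint_right m k).trans (by rw [hm0, CStarModule.inner_zero_left])

theorem IsPosDef.adjoint_comp_comp_add_projection (hD : D.IsPosDef)
    (hT : IsClosed T.adjoint.range) {P : Adjointable 𝔄 H H} (hP : P.IsProjectionOnto T.ker) :
    (T.adjoint ⊚ D ⊚ T + P).IsPosDef := by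
  refine IsPositive.isPosDef_add_projection (fun x => ?_) ?_ ?_ fun y => ?_
  · exact (hD.2 (T x)).trans_eq (T.inner_adjoint_right x _).symm
  · rw [adjoint_comp, adjoint_comp, adjoint_adjoint, hD.1.1, comp_assoc]
  · rwa [ker_adjoint_comp_comp hD]
  · obtain ⟨_, ⟨k, rfl⟩, hker⟩ := exists_mem_range_adjoint_sub_mem_ker hT y
    have hPy : P y = y - T.adjoint k := by
      rw [← hP.apply_of_mem hker, map_sub]
      exact (sub_eq_self.2 (hP.apply_adjoint_eq_zero subset_rfl k)).symm
    obtain ⟨x, -, hx⟩ := surjOn_adjoint_comp_comp hT hD ⟨k, rfl⟩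
    exact ⟨x, hx.trans (by rw [hPy, sub_sub_cancel])⟩

end ClosedRange

section Prod

variable {𝔄 H K E : Type*} [NonUnitalCStarAlgebra 𝔄] [PartialOrder 𝔄] [StarOrderedRing 𝔄]
  [NormedAddCommGroup H] [NormedSpace ℂ H] [SMul 𝔄 H] [CStarModule 𝔄 H]
  [NormedAddCommGroup K] [NormedSpace ℂ K] [SMul 𝔄 K] [CStarModule 𝔄 K]
  [NormedAddCommGroup E] [NormedSpace ℂ E] [SMul 𝔄 E] [CStarModule 𝔄 E]

/-- The column operator `x ↦ (A x, B x)` into the Hilbert module `K ⊕ E`. -/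
def prod (A : Adjointable 𝔄 H K) (B : Adjointable 𝔄 H E) :
    Adjointable 𝔄 H (WithCStarModule 𝔄 (K × E)) where
  toFun x := (WithCStarModule.equiv 𝔄 (K × E)).symm (A x, B x)
  adjFun y := A.adjoint y.1 + B.adjoint y.2
  inner_adjFun x y := by
    rw [CStarModule.inner_add_right, inner_adjoint_right, inner_adjoint_right]
    rfl

/-- The diagonal operator `V ⊕ W` on the Hilbert module `K ⊕ E`. -/
def prodMap (V : Adjointable 𝔄 K K) (W : Adjointable 𝔄 E E) :
    Adjointable 𝔄 (WithCStarModule 𝔄 (K × E)) (WithCStarModule 𝔄 (K × E)) where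
  toFun y := (WithCStarModule.equiv 𝔄 (K × E)).symm (V y.1, W y.2)
  adjFun y := (WithCStarModule.equiv 𝔄 (K × E)).symm (V.adjoint y.1, W.adjoint y.2)
  inner_adjFun x y := congrArg₂ (· + ·) (V.inner_adjFun x.1 y.1) (W.inner_adjFun x.2 y.2)

variable {A : Adjointable 𝔄 H K} {B : Adjointable 𝔄 H E} {V : Adjointable 𝔄 K K}
  {W : Adjointable 𝔄 E E}

theorem ker_prod : (A.prod B).ker = A.ker ∩ B.ker :=
  Set.ext fun _ => Prod.mk_eq_zero

theorem range_adjoint_prod : (A.prod B).adjoint.range = A.adjoint.range + B.adjoint.range := by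
  ext x
  constructor
  · rintro ⟨y, rfl⟩
    exact Set.add_mem_add ⟨y.1, rfl⟩ ⟨y.2, rfl⟩
  · rintro ⟨_, ⟨k, rfl⟩, _, ⟨e, rfl⟩, rfl⟩
    exact ⟨(WithCStarModule.equiv 𝔄 (K × E)).symm (k, e), rfl⟩

theorem adjoint_prod_comp_prodMap_comp_prod :
    (A.prod B).adjoint ⊚ V.prodMap W ⊚ A.prod B =
      A.adjoint ⊚ V ⊚ A + B.adjoint ⊚ W ⊚ B := rfl

theorem IsPosDef.prodMap (hV : V.IsPosDef) (hW : W.IsPosDef) : (V.prodMap W).IsPosDef := by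
  obtain ⟨⟨hVadj, N, hVN, hNV⟩, hVpos⟩ := hV
  obtain ⟨⟨hWadj, M, hWM, hMW⟩, hWpos⟩ := hW
  refine ⟨⟨?_, N.prodMap M, ext fun y => ?_, ext fun y => ?_⟩,
    fun y => add_nonneg (hVpos y.1) (hWpos y.2)⟩
  · change V.adjoint.prodMap W.adjoint = V.prodMap W
    rw [hVadj, hWadj]
  · exact Prod.ext (congr_apply hVN y.1) (congr_apply hWM y.2)
  · exact Prod.ext (congr_apply hNV y.1) (congr_apply hMW y.2)

end Prod

section WeightedInverse

variable {𝔄 H K E : Type*} [NonUnitalCStarAlgebra 𝔄] [PartialOrder 𝔄] [StarOrderedRing 𝔄]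
  [NormedAddCommGroup H] [NormedSpace ℂ H] [SMul 𝔄 H] [CStarModule 𝔄 H]
  [NormedAddCommGroup K] [NormedSpace ℂ K] [SMul 𝔄 K] [CStarModule 𝔄 K]
  [NormedAddCommGroup E] [NormedSpace ℂ E] [SMul 𝔄 E] [CStarModule 𝔄 E]
  {A : Adjointable 𝔄 H K} {B : Adjointable 𝔄 H E} {V : Adjointable 𝔄 K K}
  {W : Adjointable 𝔄 E E} {P Q : Adjointable 𝔄 H H}

theorem adjoint_comp_smul_comp (t : ℝ) :
    B.adjoint ⊚ (t • W) ⊚ B = t • (B.adjoint ⊚ W ⊚ B) :=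
  ext fun x => B.adjoint.map_smul t (W (B x))

theorem isWeightedMPInverse_of_comp_eq_id {U : Adjointable 𝔄 H H} (hV : V.adjoint = V)
    (hU : U.adjoint = U) (hUQ : U ⊚ Q = Adjointable.id 𝔄 H)
    (hA : A.adjoint ⊚ V ⊚ A ⊚ Q ⊚ A.adjoint = A.adjoint) :
    IsWeightedMPInverse V U A (Q ⊚ A.adjoint ⊚ V) := by
  have hQ := adjoint_eq_self_of_comp_eq_id hU hUQ
  have hUXA : U ⊚ (Q ⊚ A.adjoint ⊚ V) ⊚ A = A.adjoint ⊚ V ⊚ A :=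
    congrArg (· ⊚ A.adjoint ⊚ V ⊚ A) hUQ
  refine ⟨?_, congrArg (Q ⊚ · ⊚ V) hA, ?_, ?_⟩
  · have hAadj := congrArg adjoint hA
    simp only [adjoint_comp, adjoint_adjoint, hQ, hV] at hAadj
    exact hAadj
  · simp only [adjoint_comp, adjoint_adjoint, hQ, hV, comp_assoc]
  · rw [hUXA]
    simp only [adjoint_comp, adjoint_adjoint, hV, comp_assoc]

variable [CompleteSpace E]

theorem decoupled_of_apply_eq_adjoint
    (hdisj : A.adjoint.range ∩ B.adjoint.range = {0}) (hP : P.IsProjectionOnto (A.ker ∩ B.ker))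
    (hW : W.IsPosDef) {q : H} {k : K}
    (hq : (A.adjoint ⊚ V ⊚ A + B.adjoint ⊚ W ⊚ B + P) q = A.adjoint k) :
    A.adjoint (V (A q)) = A.adjoint k ∧ B q = 0 ∧ P q = 0 := by
  have hsum : A.adjoint (V (A q)) + B.adjoint (W (B q)) + P q = A.adjoint k := hq
  have hPq : P q = 0 := by
    have h := congrArg P hsum
    rwa [map_add, map_add, hP.apply_adjoint_eq_zero Set.inter_subset_left,
      hP.apply_adjoint_eq_zero Set.inter_subset_right,
      hP.apply_adjoint_eq_zero Set.inter_subset_left, hP.apply_of_mem (hP.apply_mem q),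
      zero_add, zero_add] at h
  rw [hPq, add_zero] at hsum
  have hBq : B.adjoint (W (B q)) = 0 := by
    have hmem : B.adjoint (W (B q)) ∈ A.adjoint.range ∩ B.adjoint.range :=
      ⟨⟨k - V (A q), (A.adjoint.map_sub _ _).trans (sub_eq_of_eq_add' hsum.symm)⟩, _, rfl⟩
    rwa [hdisj] at hmem
  refine ⟨by rwa [hBq, add_zero] at hsum, hW.eq_zero_of_inner_eq_zero (𝔄 := 𝔄) ?_, hPq⟩
  rw [← B.inner_adjoint_right, hBq, CStarModule.inner_zero_right]

theorem adjoint_comp_comp_inverse_comp_adjoint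
    (hdisj : A.adjoint.range ∩ B.adjoint.range = {0}) (hP : P.IsProjectionOnto (A.ker ∩ B.ker))
    (hW : W.IsPosDef)
    (hQ : (A.adjoint ⊚ V ⊚ A + B.adjoint ⊚ W ⊚ B + P) ⊚ Q = Adjointable.id 𝔄 H) :
    A.adjoint ⊚ V ⊚ A ⊚ Q ⊚ A.adjoint = A.adjoint :=
  ext fun k => (decoupled_of_apply_eq_adjoint hdisj hP hW (congr_apply hQ (A.adjoint k))).1

theorem inverse_comp_adjoint_eq
    (hdisj : A.adjoint.range ∩ B.adjoint.range = {0}) (hP : P.IsProjectionOnto (A.ker ∩ B.ker))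
    (hW : W.IsPosDef) {W' : Adjointable 𝔄 E E} {Q' : Adjointable 𝔄 H H}
    (hQ : (A.adjoint ⊚ V ⊚ A + B.adjoint ⊚ W ⊚ B + P) ⊚ Q = Adjointable.id 𝔄 H)
    (hQ' : Q' ⊚ (A.adjoint ⊚ V ⊚ A + B.adjoint ⊚ W' ⊚ B + P) = Adjointable.id 𝔄 H) :
    Q' ⊚ A.adjoint = Q ⊚ A.adjoint := by
  refine ext fun k => ?_
  obtain ⟨hA, hB, hPq⟩ :=
    decoupled_of_apply_eq_adjoint hdisj hP hW (congr_apply hQ (A.adjoint k))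
  have hsolves : A.adjoint (V (A (Q (A.adjoint k)))) + B.adjoint (W' (B (Q (A.adjoint k)))) +
      P (Q (A.adjoint k)) = A.adjoint k := by
    rw [hA, hB, hPq, map_zero, map_zero, add_zero, add_zero]
  exact (congrArg Q' hsolves).symm.trans (congr_apply hQ' (Q (A.adjoint k)))

theorem exists_isMPInverse_comp_adjoint_eq [CompleteSpace K]
    (hdisj : A.adjoint.range ∩ B.adjoint.range = {0}) (hP : P.IsProjectionOnto (A.ker ∩ B.ker))
    (hV : V.IsPosDef) (hW : W.IsPosDef)
    (hQ : (A.adjoint ⊚ V ⊚ A + B.adjoint ⊚ W ⊚ B + P) ⊚ Q = Adjointable.id 𝔄 H)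
    (hQ' : Q ⊚ (A.adjoint ⊚ V ⊚ A + B.adjoint ⊚ W ⊚ B + P) = Adjointable.id 𝔄 H) :
    ∃ Y : Adjointable 𝔄 H H, IsMPInverse (A.adjoint ⊚ V ⊚ A + B.adjoint ⊚ W ⊚ B) Y ∧
      Y ⊚ A.adjoint = Q ⊚ A.adjoint := by
  have hVW := hV.prodMap hW
  have hSP : P.IsProjectionOnto (A.adjoint ⊚ V ⊚ A + B.adjoint ⊚ W ⊚ B).ker := by
    rwa [← adjoint_prod_comp_prodMap_comp_prod, ker_adjoint_comp_comp hVW, ker_prod]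
  have hSadj : (A.adjoint ⊚ V ⊚ A + B.adjoint ⊚ W ⊚ B).adjoint =
      A.adjoint ⊚ V ⊚ A + B.adjoint ⊚ W ⊚ B := by
    simp only [adjoint_add, adjoint_comp, adjoint_adjoint, hV.1.1, hW.1.1, comp_assoc]
  refine ⟨_, isMPInverse_of_inverse_add_projection hSadj hSP hQ hQ', ext fun k => ?_⟩
  obtain ⟨hA, hB, -⟩ := decoupled_of_apply_eq_adjoint hdisj hP hW (congr_apply hQ (A.adjoint k))
  refine congrArg Q (?_ : A.adjoint (V (A (Q (A.adjoint k)))) +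
    B.adjoint (W (B (Q (A.adjoint k)))) = A.adjoint k)
  rw [hA, hB, map_zero, map_zero, add_zero]

end WeightedInverse

end Adjointable

theorem mainTheorem11 {𝔄 H K E : Type*}
    [NonUnitalCStarAlgebra 𝔄] [PartialOrder 𝔄] [StarOrderedRing 𝔄]
    [NormedAddCommGroup H] [NormedSpace ℂ H] [SMul 𝔄 H] [CStarModule 𝔄 H] [CompleteSpace H]
    [NormedAddCommGroup K] [NormedSpace ℂ K] [SMul 𝔄 K] [CStarModule 𝔄 K] [CompleteSpace K]
    [NormedAddCommGroup E] [NormedSpace ℂ E] [SMul 𝔄 E] [CStarModule 𝔄 E] [CompleteSpace E]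
    (A : Adjointable 𝔄 H K) (B : Adjointable 𝔄 H E) (V : Adjointable 𝔄 K K)
    (hAB : Adjointable.IsSeparatedPair A B) (hV : V.IsPosDef) :
    -- the projection onto the common null space exists
    ∃ P : Adjointable 𝔄 H H, P.IsProjectionOnto (A.ker ∩ B.ker) ∧
      -- one operator `X`, chosen before `W` and `t`
      ∃ X : Adjointable 𝔄 K H, ∀ W : Adjointable 𝔄 E E, W.IsPosDef →
        (A.adjoint ⊚ V ⊚ A + B.adjoint ⊚ W ⊚ B + P).IsPosDef ∧
        Adjointable.IsWeightedMPInverse V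
          (A.adjoint ⊚ V ⊚ A + B.adjoint ⊚ W ⊚ B + P) A X ∧
        ∀ t : ℝ, 0 < t → ∃ Y : Adjointable 𝔄 H H,
          Adjointable.IsMPInverse (A.adjoint ⊚ V ⊚ A + t • (B.adjoint ⊚ W ⊚ B)) Y ∧
          Y ⊚ A.adjoint ⊚ V = X := by
  obtain ⟨hdisj, hclosed⟩ := hAB
  rw [← Adjointable.range_adjoint_prod] at hclosed
  obtain ⟨P, hPker⟩ := Adjointable.exists_isProjectionOnto_ker hclosed
  have hU : ∀ W : Adjointable 𝔄 E E, W.IsPosDef →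
      (A.adjoint ⊚ V ⊚ A + B.adjoint ⊚ W ⊚ B + P).IsPosDef := fun W hW =>
    (hV.prodMap hW).adjoint_comp_comp_add_projection hclosed hPker
  have hP : P.IsProjectionOnto (A.ker ∩ B.ker) := by rwa [Adjointable.ker_prod] at hPker
  obtain ⟨⟨-, Q₁, hQ₁, -⟩, -⟩ := hU (Adjointable.id 𝔄 E) Adjointable.isPosDef_id
  have hQA : ∀ {W : Adjointable 𝔄 E E} {Q : Adjointable 𝔄 H H},
      Q ⊚ (A.adjoint ⊚ V ⊚ A + B.adjoint ⊚ W ⊚ B + P) = Adjointable.id 𝔄 H →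
      Q ⊚ A.adjoint = Q₁ ⊚ A.adjoint :=
    Adjointable.inverse_comp_adjoint_eq hdisj hP Adjointable.isPosDef_id hQ₁
  refine ⟨P, hP, (Q₁ ⊚ A.adjoint) ⊚ V, fun W hW => ⟨hU W hW, ?_, fun t ht => ?_⟩⟩
  · obtain ⟨⟨hUadj, Q, hUQ, hQU⟩, -⟩ := hU W hW
    rw [← hQA hQU]
    exact Adjointable.isWeightedMPInverse_of_comp_eq_id hV.1.1 hUadj hUQ
      (Adjointable.adjoint_comp_comp_inverse_comp_adjoint hdisj hP hW hUQ)
  · obtain ⟨⟨-, Q, hUQ, hQU⟩, -⟩ := hU _ (hW.smul ht)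
    obtain ⟨Y, hY, hYA⟩ :=
      Adjointable.exists_isMPInverse_comp_adjoint_eq hdisj hP hV (hW.smul ht) hUQ hQU
    exact ⟨Y, Adjointable.adjoint_comp_smul_comp (B := B) (W := W) t ▸ hY,
      congrArg (· ⊚ V) (hYA.trans (hQA hQU))⟩
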